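/- Let $\|\cdot\|$ be an arbitrary norm on $\mathbb{R}^d$, with dual norm $\|u\|_*=\sup_{\|v\|\le 1}\langle u,v\rangle$; let $\|\cdot\|_2$ be the Euclidean norm, and let $\bar\rho\ge 0$, $\underline\theta>0$ be constants with $\|v\|_*\le\bar\rho\|v\|_2$ and $\underline\theta\|v\|_2\le\|v\|$ for all $v$. Let $f(x)=\mathbb{E}_{\xi\sim\mathcal{D}}[f_\xi(x)]$, where $f$ and every $f_\xi$ are twice differentiable on $\mathbb{R}^d$, and let $\sigma_g,\sigma_H,L_0,L_1,M_0,M_1\ge 0$ with $L_1,M_1$ not both zero. Assume that for all $x,y,w\in\mathbb{R}^d$: (i) $\mathbb{E}_\xi[\nabla f_\xi(x)]=\nabla f(x)$, $\mathbb{E}_\xi\|\nabla f_\xi(x)-\nabla f(x)\|_2^2\le\sigma_g^2$, $\mathbb{E}_\xi[\nabla^2 f_\xi(x)]=\nabla^2 f(x)$, and $\mathbb{E}_\xi\|(\nabla^2 f_\xi(x)-\nabla^2 f(x))w\|_2^2\le\sigma_H^2\|w\|_2^2$; (ii) $f_{\inf}:=\inf_{x} f(x)>-\infty$; (iii) $\|\nabla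 f(x)-\nabla f(y)\|_*\le\bigl(L_0+L_1\sup_{\theta\in[0,1]}\|\nabla f(\theta x+(1-\theta)y)\|_*\bigr)\|x-y\|$; (iv) $\|\nabla^2 f(x)-\nabla^2 f(y)\|_*\le\bigl(M_0+M_1\sup_{\theta\in[0,1]}\|\nabla f(\theta x+(1-\theta)y)\|_*\bigr)\|x-y\|$, where for a matrix $A$ we write $\|A\|_*=\sup_{u\ne 0}\|Au\|_*/\|u\|$. Let $\hat\eta=\frac13\min\{1/L_1,\,1/\sqrt{M_1}\}$ (with $1/0=+\infty$). Fix an integer $K\ge 1$, and put $\alpha=(K+1)^{-2/3}$, $\beta=1-\alpha$ and $\eta=\hat\eta\,(K+1)^{-2/3}$. Starting from a point $x_0\in\mathbb{R}^d$ and a (possibly random, integrable) $m_0$, for $k=0,\dots,K$ let $$x_{k+1}=x_k+v_k,\qquad v_k\in\operatorname*{argmin}_{\|v\|\le\eta}\langle m_k,v\rangle,$$ draw a fresh sample $\xi_{k+1}\sim\mathcal{D}$, independent of $m_0,\xi_1,\dots,\xi_k$ and $x_1,\dots,x_{k+1}$, and let $$m_{k+1}=(1-\alpha)\Bigl(m_k+\tfrac{\beta}{1-\alpha}\nabla^2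 f_{\xi_{k+1}}(x_{k+1})(x_{k+1}-x_k)\Bigr)+\alpha\nabla f_{\xi_{k+1}}(x_{k+1}).$$ Then each $\|\nabla f(x_k)\|_*$, $0\le k\le K$, is integrable, and with $e_0=m_0-\nabla f(x_0)$, $$\min_{0\le k\le K}\mathbb{E}\|\nabla f(x_k)\|_*\le\frac{2(f(x_0)-f_{\inf})}{\hat\eta(K+1)^{1/3}}+\frac{4(\mathbb{E}\|e_0\|_*+\bar\rho\sigma_g)}{(K+1)^{1/3}}+\frac{\hat\eta L_0\exp(L_1\hat\eta)}{(K+1)^{2/3}}+\frac{2\hat\eta^2}{(K+1)^{2/3}}\Bigl(M_0+\tfrac23M_1\hat\eta L_0\exp(L_1\hat\eta)\Bigr)+4\,\frac{\bar\rho}{\underline\theta}\,\frac{\hat\eta\sigma_H}{(K+1)^{1/3}}.$$ -/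

import Mathlib

open MeasureTheory ProbabilityTheory

/-- `ℝ^d` with the Euclidean inner product and norm. -/
abbrev Vec (d : ℕ) : Type := EuclideanSpace ℝ (Fin d)

/-- The dual norm `‖u‖_* = sup_{‖v‖ ≤ 1} ⟨u, v⟩` of the norm `p`. -/
noncomputable def dualNorm {d : ℕ} (p : Seminorm ℝ (Vec d)) (u : Vec d) : ℝ :=
  sSup ((fun v : Vec d => inner ℝ u v) '' {v | p v ≤ 1})

/-- The operator norm `sup_{u ≠ 0} ‖A u‖_* / ‖u‖` of a matrix, from `p` to its dual norm. -/
noncomputable def opDualNorm {d : ℕ} (p : Seminorm ℝ (Vec d)) (A : Vec d →L[ℝ] Vec d) : ℝ :=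
  sSup ((fun u : Vec d => dualNorm p (A u) / p u) '' {u | u ≠ 0})

/-- The Hessian, as the derivative of the gradient. -/
noncomputable def hessian {d : ℕ} (f : Vec d → ℝ) (x : Vec d) : Vec d →L[ℝ] Vec d :=
  fderiv ℝ (gradient f) x

/-- `f` is twice differentiable on `ℝ^d`. -/
def TwiceDifferentiable {d : ℕ} (f : Vec d → ℝ) : Prop :=
  Differentiable ℝ f ∧ Differentiable ℝ (gradient f)

/-- `sup_{θ ∈ [0,1]} ‖∇f(θ x + (1-θ) y)‖_*`. -/
noncomputable def segmentGradSup {d : ℕ} (p : Seminorm ℝ (Vec d)) (f : Vec d → ℝ)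
    (x y : Vec d) : ℝ :=
  sSup ((fun θ : ℝ => dualNorm p (gradient f (θ • x + (1 - θ) • y))) '' Set.Icc (0 : ℝ) 1)

/-- The gradient of `f` is symmetrically `(L₀, L₁)`-Lipschitz with respect to `p`. -/
def SymmLipschitzGradient {d : ℕ} (p : Seminorm ℝ (Vec d)) (L₀ L₁ : ℝ) (f : Vec d → ℝ) : Prop :=
  ∀ x y : Vec d,
    dualNorm p (gradient f x - gradient f y) ≤ (L₀ + L₁ * segmentGradSup p f x y) * p (x - y)

/-- The Hessian of `f` is symmetrically `(M₀, M₁)`-Lipschitz with respect to `p`. -/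
def SymmLipschitzHessian {d : ℕ} (p : Seminorm ℝ (Vec d)) (M₀ M₁ : ℝ) (f : Vec d → ℝ) : Prop :=
  ∀ x y : Vec d,
    opDualNorm p (hessian f x - hessian f y) ≤ (M₀ + M₁ * segmentGradSup p f x y) * p (x - y)

/-- `F` is a random function with `f(x) = E_ξ f_ξ(x)`: each `f_ξ = F ξ` is twice differentiable,
and `f_ξ(x)` is measurable in `ξ` and integrable with mean `f(x)`. -/
structure IsStochasticObjective {d : ℕ} {Ξ : Type*} [MeasurableSpace Ξ] (D : Measure Ξ)
    (F : Ξ → Vec d → ℝ) (f : Vec d → ℝ) : Prop where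
  measurable : ∀ x, Measurable fun ξ => F ξ x
  twiceDifferentiable : ∀ ξ, TwiceDifferentiable (F ξ)
  integrable : ∀ x, Integrable (fun ξ => F ξ x) D
  mean_eq : ∀ x, f x = ∫ ξ, F ξ x ∂D

/-- The stochastic gradients and Hessians are unbiased, with variances bounded (in the Euclidean
norm) through `σg` and `σH`. -/
structure UnbiasedBoundedVariance {d : ℕ} {Ξ : Type*} [MeasurableSpace Ξ] (D : Measure Ξ)
    (F : Ξ → Vec d → ℝ) (f : Vec d → ℝ) (σg σH : ℝ) : Prop where
  grad_integrable : ∀ x, Integrable (fun ξ => gradient (F ξ) x) D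
  grad_mean : ∀ x, ∫ ξ, gradient (F ξ) x ∂D = gradient f x
  grad_sq_integrable : ∀ x, Integrable (fun ξ => ‖gradient (F ξ) x - gradient f x‖ ^ 2) D
  grad_variance : ∀ x, ∫ ξ, ‖gradient (F ξ) x - gradient f x‖ ^ 2 ∂D ≤ σg ^ 2
  hess_integrable : ∀ x, Integrable (fun ξ => hessian (F ξ) x) D
  hess_mean : ∀ x, ∫ ξ, hessian (F ξ) x ∂D = hessian f x
  hess_sq_integrable : ∀ x w,
    Integrable (fun ξ => ‖(hessian (F ξ) x - hessian f x) w‖ ^ 2) D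
  hess_variance : ∀ x w,
    ∫ ξ, ‖(hessian (F ξ) x - hessian f x) w‖ ^ 2 ∂D ≤ σH ^ 2 * ‖w‖ ^ 2

/-- The linear minimization oracle: the set of minimizers of `⟨m, v⟩` over `p v ≤ η`. -/
def lmo {d : ℕ} (p : Seminorm ℝ (Vec d)) (η : ℝ) (m : Vec d) : Set (Vec d) :=
  {v | p v ≤ η ∧ ∀ w : Vec d, p w ≤ η → inner ℝ m v ≤ inner ℝ m w}

/-- `x`, `m` are the iterates of the LMO-based method with second-order momentum whose stochastic
Hessian is taken at the new point `x (k+1)`, run for the iterations `k = 0, …, K` from the point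
`x₀` with parameters `η k`, `α k`, `β k`, on samples `ξ (k+1)` from `D`.
`ℱ k` is the information available once the samples `ξ 1, …, ξ k` have been drawn. The initial
momentum `m 0` may be random; any minimizer may be returned by the oracle, as long as
it does not depend on samples that have not been drawn yet. -/
structure IsSecondOrderMomentumRun {d : ℕ} {Ξ Ω : Type*} [MeasurableSpace Ξ] [MeasurableSpace Ω]
    (P : Measure Ω) (D : Measure Ξ) (F : Ξ → Vec d → ℝ) (p : Seminorm ℝ (Vec d))
    (ℱ : Filtration ℕ (inferInstance : MeasurableSpace Ω))
    (η α β : ℕ → ℝ) (K : ℕ) (x₀ : Vec d)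
    (ξ : ℕ → Ω → Ξ) (x m : ℕ → Ω → Vec d) : Prop where
  init_point : ∀ ω, x 0 ω = x₀
  init_momentum_measurable : Measurable[ℱ 0] (m 0)
  /-- `x (k+1)` is determined before `ξ (k+1)` is drawn. -/
  point_measurable : ∀ k ≤ K, Measurable[ℱ k] (x (k + 1))
  point_step : ∀ k ≤ K, ∀ ω, x (k + 1) ω - x k ω ∈ lmo p (η k) (m k ω)
  sample_measurable : ∀ k ≤ K, Measurable[ℱ (k + 1)] (ξ (k + 1))
  sample_law : ∀ k ≤ K, P.map (ξ (k + 1)) = D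
  /-- `ξ (k+1)` is a fresh sample. -/
  sample_indep : ∀ k ≤ K, Indep (MeasurableSpace.comap (ξ (k + 1)) inferInstance) (ℱ k) P
  momentum_step : ∀ k ≤ K, ∀ ω,
    m (k + 1) ω =
      (1 - α k) • (m k ω +
        (β k / (1 - α k)) • hessian (F (ξ (k + 1) ω)) (x (k + 1) ω) (x (k + 1) ω - x k ω))
      + α k • gradient (F (ξ (k + 1) ω)) (x (k + 1) ω)

/-- `(1/3) min {1/L₁, 1/√M₁}`, with `1/0 = ∞`; it is finite unless `L₁ = M₁ = 0`. -/
noncomputable def etaHat (L₁ M₁ : ℝ) : ℝ :=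
  (min (ENNReal.ofReal L₁)⁻¹ (ENNReal.ofReal (√M₁))⁻¹).toReal / 3

/-!
The argument follows one sample path deterministically and averages only at the end.

Along a path, subtract from the momentum error `m k - ∇f (x k)` the accumulated sampling noise
`S k`, a discounted sum of the gradient and Hessian noises (`noiseSum`). The remainder `E k` then
satisfies `E (k+1) = (1 - α) (E k + R k)`, where `R k` is the remainder in the first-order Taylor
expansion of `∇f` about `x (k+1)`, evaluated at `x k` (`momentum_error_step`). This is
what the Hessian correction buys: `R k` is of order `η²` (`dualNorm_gradient_taylor_le`).
Together with the descent inequality for a linear minimization step,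
`f (x k) / η + (2 / α) ‖E k‖_*` is a potential whose decrease controls
`‖∇f (x k)‖_* / 2` up to noise and curvature constants (`half_dualNorm_gradient_le`), and the sum
over `k` telescopes.

The curvature constants involve the supremum of `‖∇f‖_*` over the segment of a step. It occurs on
both sides of the Lipschitz bound of the gradient, and since `L₁ η < 1` that bound can be solved for
it: the supremum is at most `(‖∇f (x k)‖_* + L₀ η) / (1 - L₁ η)` (`segmentGradSup_le_of_step`). The
part proportional to `‖∇f (x k)‖_*` is absorbed in the left side, thanks to `L₁ ηhat ≤ 1/3`,
`M₁ ηhat² ≤ 1/9` and `(K + 1) ^ (-2/3) ≤ 2/3`; the last of these also gives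
`1 / (1 - L₁ η) ≤ exp (L₁ ηhat)`.

In expectation the noise is small because each sample is independent of the past: the cross terms
vanish, so a discounted sum of centred noises with second moments at most `C²` has second moment at
most `C² / α` (`integrable_and_integral_sq_noiseSum_le`). Here `C` is `α σg` for the gradients and
`σH η / θlow` for the Hessians. Independence enters through Fubini's theorem on the product of the
law of the past with `D`, which needs the stochastic gradients and Hessians to be jointly measurable
in the sample and the point (`measurable_gradient_uncurry`, `measurable_hessian_uncurry`).
-/

/-! ### The dual norm -/

section DualNorm

variable {d : ℕ} {p : Seminorm ℝ (Vec d)} {θ : ℝ}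

lemma dualNorm_bddAbove (hθ : 0 < θ) (hp : ∀ v : Vec d, θ * ‖v‖ ≤ p v) (u : Vec d) :
    BddAbove ((fun v : Vec d => inner ℝ u v) '' {v | p v ≤ 1}) := by
  refine ⟨‖u‖ * θ⁻¹, ?_⟩
  rintro _ ⟨v, hv, rfl⟩
  have hv' : ‖v‖ ≤ θ⁻¹ := by
    rw [inv_eq_one_div, le_div_iff₀ hθ, mul_comm]
    exact (hp v).trans hv
  exact (real_inner_le_norm u v).trans (by gcongr)

lemma inner_le_dualNorm_of_le_one (hθ : 0 < θ) (hp : ∀ v : Vec d, θ * ‖v‖ ≤ p v) (u : Vec d)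
    {v : Vec d} (hv : p v ≤ 1) : inner ℝ u v ≤ dualNorm p u :=
  le_csSup (dualNorm_bddAbove hθ hp u) ⟨v, hv, rfl⟩

lemma dualNorm_le_of_forall {u : Vec d} {c : ℝ} (h : ∀ v, p v ≤ 1 → inner ℝ u v ≤ c) :
    dualNorm p u ≤ c := by
  refine csSup_le ⟨_, 0, by simp, rfl⟩ ?_
  rintro _ ⟨v, hv, rfl⟩
  exact h v hv

lemma dualNorm_nonneg (hθ : 0 < θ) (hp : ∀ v : Vec d, θ * ‖v‖ ≤ p v) (u : Vec d) :
    0 ≤ dualNorm p u := by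
  simpa using inner_le_dualNorm_of_le_one hθ hp u (v := 0) (by simp)

lemma inner_le_dualNorm_mul (hθ : 0 < θ) (hp : ∀ v : Vec d, θ * ‖v‖ ≤ p v) (u v : Vec d) :
    inner ℝ u v ≤ dualNorm p u * p v := by
  rcases eq_or_ne v 0 with rfl | hv
  · simp
  have hpv : 0 < p v := (mul_pos hθ (norm_pos_iff.2 hv)).trans_le (hp v)
  have h := inner_le_dualNorm_of_le_one hθ hp u (v := (p v)⁻¹ • v) (by
    rw [map_smul_eq_mul, Real.norm_of_nonneg (inv_nonneg.2 hpv.le), inv_mul_cancel₀ hpv.ne'])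
  rw [inner_smul_right, inv_mul_eq_div, div_le_iff₀ hpv] at h
  exact h

lemma dualNorm_add_le (hθ : 0 < θ) (hp : ∀ v : Vec d, θ * ‖v‖ ≤ p v) (u w : Vec d) :
    dualNorm p (u + w) ≤ dualNorm p u + dualNorm p w := by
  refine dualNorm_le_of_forall fun v hv => ?_
  rw [inner_add_left]
  exact add_le_add (inner_le_dualNorm_of_le_one hθ hp u hv)
    (inner_le_dualNorm_of_le_one hθ hp w hv)

lemma dualNorm_smul_le (hθ : 0 < θ) (hp : ∀ v : Vec d, θ * ‖v‖ ≤ p v) {c : ℝ} (hc : 0 ≤ c)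
    (u : Vec d) : dualNorm p (c • u) ≤ c * dualNorm p u := by
  refine dualNorm_le_of_forall fun v hv => ?_
  rw [real_inner_smul_left]
  exact mul_le_mul_of_nonneg_left (inner_le_dualNorm_of_le_one hθ hp u hv) hc

lemma dualNorm_neg_le (hθ : 0 < θ) (hp : ∀ v : Vec d, θ * ‖v‖ ≤ p v) (u : Vec d) :
    dualNorm p (-u) ≤ dualNorm p u := by
  refine dualNorm_le_of_forall fun v hv => ?_
  simpa using inner_le_dualNorm_of_le_one hθ hp u (v := -v) (by simpa using hv)

lemma dualNorm_le_norm (hθ : 0 < θ) (hp : ∀ v : Vec d, θ * ‖v‖ ≤ p v) (u : Vec d) :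
    dualNorm p u ≤ θ⁻¹ * ‖u‖ := by
  refine dualNorm_le_of_forall fun v hv => ?_
  have hv' : ‖v‖ ≤ θ⁻¹ := by
    rw [inv_eq_one_div, le_div_iff₀ hθ, mul_comm]
    exact (hp v).trans hv
  exact (real_inner_le_norm u v).trans (by rw [mul_comm]; gcongr)

lemma dualNorm_sub_dualNorm_le (hθ : 0 < θ) (hp : ∀ v : Vec d, θ * ‖v‖ ≤ p v) (u w : Vec d) :
    dualNorm p u - dualNorm p w ≤ dualNorm p (u - w) := by
  have h := dualNorm_add_le hθ hp (u - w) w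
  rw [sub_add_cancel] at h
  linarith

lemma continuous_dualNorm (hθ : 0 < θ) (hp : ∀ v : Vec d, θ * ‖v‖ ≤ p v) :
    Continuous (dualNorm p) := by
  refine (LipschitzWith.of_le_add_mul (Real.toNNReal θ⁻¹) fun u w => ?_).continuous
  rw [Real.coe_toNNReal _ (inv_nonneg.2 hθ.le), dist_eq_norm]
  linarith [dualNorm_sub_dualNorm_le hθ hp u w, dualNorm_le_norm hθ hp (u - w)]

lemma dualNorm_apply_le_opDualNorm (hθ : 0 < θ) (hp : ∀ v : Vec d, θ * ‖v‖ ≤ p v)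
    (A : Vec d →L[ℝ] Vec d) (u : Vec d) : dualNorm p (A u) ≤ opDualNorm p A * p u := by
  rcases eq_or_ne u 0 with rfl | hu
  · simpa using dualNorm_le_norm hθ hp (0 : Vec d)
  have hpu : ∀ u : Vec d, u ≠ 0 → 0 < p u := fun u hu =>
    (mul_pos hθ (norm_pos_iff.2 hu)).trans_le (hp u)
  rw [← div_le_iff₀ (hpu u hu)]
  refine le_csSup ⟨θ⁻¹ * ‖A‖ * θ⁻¹, ?_⟩ ⟨u, hu, rfl⟩
  rintro _ ⟨w, hw, rfl⟩
  change dualNorm p (A w) / p w ≤ _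
  rw [div_le_iff₀ (hpu w hw)]
  calc dualNorm p (A w) ≤ θ⁻¹ * (‖A‖ * ‖w‖) :=
        (dualNorm_le_norm hθ hp _).trans (by gcongr; exact A.le_opNorm w)
    _ = θ⁻¹ * ‖A‖ * θ⁻¹ * (θ * ‖w‖) := by field_simp
    _ ≤ _ := by gcongr; exact hp w

/-- A minimizer of `⟨m, ·⟩` over the ball of radius `η` attains the value `-η ‖m‖_*`. -/
lemma inner_le_of_mem_lmo {η : ℝ} (hη : 0 < η) {m v : Vec d} (hv : v ∈ lmo p η m) :
    inner ℝ m v ≤ -(η * dualNorm p m) := by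
  have h : dualNorm p m ≤ -inner ℝ m v / η := by
    refine dualNorm_le_of_forall fun w hw => ?_
    have := hv.2 (-(η • w)) (by
      rw [map_neg_eq_map, map_smul_eq_mul, Real.norm_of_nonneg hη.le]
      exact mul_le_of_le_one_right hη.le hw)
    rw [inner_neg_right, inner_smul_right] at this
    rw [le_div_iff₀ hη]
    linarith
  rw [le_div_iff₀ hη] at h
  linarith

end DualNorm

/-! ### Gradient growth, descent and Taylor estimates along a segment -/

section Smoothness

variable {d : ℕ} {p : Seminorm ℝ (Vec d)} {θ : ℝ} {f : Vec d → ℝ}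

lemma dualNorm_gradient_le_segmentGradSup (hθ : 0 < θ) (hp : ∀ v : Vec d, θ * ‖v‖ ≤ p v)
    (hf : Continuous (gradient f)) (x y : Vec d) {t : ℝ} (ht : t ∈ Set.Icc (0 : ℝ) 1) :
    dualNorm p (gradient f (t • x + (1 - t) • y)) ≤ segmentGradSup p f x y := by
  refine le_csSup (IsCompact.bddAbove_image isCompact_Icc ?_) ⟨t, ht, rfl⟩
  exact ((continuous_dualNorm hθ hp).comp (hf.comp (by fun_prop))).continuousOn

lemma segmentGradSup_le {x y : Vec d} {c : ℝ}
    (h : ∀ t ∈ Set.Icc (0 : ℝ) 1, dualNorm p (gradient f (t • x + (1 - t) • y)) ≤ c) :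
    segmentGradSup p f x y ≤ c := by
  refine csSup_le ⟨_, 0, by simp, rfl⟩ ?_
  rintro _ ⟨t, ht, rfl⟩
  exact h t ht

/-- The supremum of the gradient does not increase when a segment is shortened. -/
lemma segmentGradSup_mono (hθ : 0 < θ) (hp : ∀ v : Vec d, θ * ‖v‖ ≤ p v)
    (hf : Continuous (gradient f)) (x y : Vec d) {t : ℝ} (ht : t ∈ Set.Icc (0 : ℝ) 1) :
    segmentGradSup p f (t • x + (1 - t) • y) y ≤ segmentGradSup p f x y := by
  refine segmentGradSup_le fun s hs => ?_
  have h := dualNorm_gradient_le_segmentGradSup hθ hp hf x y (t := s * t)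
    ⟨mul_nonneg hs.1 ht.1, mul_le_one₀ hs.2 ht.1 ht.2⟩
  convert h using 3
  module

lemma segmentGradSup_comm (x y : Vec d) : segmentGradSup p f x y = segmentGradSup p f y x := by
  have key : ∀ x y : Vec d,
      (fun t : ℝ => dualNorm p (gradient f (t • x + (1 - t) • y))) '' Set.Icc (0 : ℝ) 1 ⊆
      (fun t : ℝ => dualNorm p (gradient f (t • y + (1 - t) • x))) '' Set.Icc (0 : ℝ) 1 := by
    rintro x y _ ⟨t, ht, rfl⟩
    refine ⟨1 - t, ⟨by linarith [ht.2], by linarith [ht.1]⟩, ?_⟩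
    simp only [sub_sub_cancel]
    rw [add_comm]
  exact congrArg sSup ((key x y).antisymm (key y x))

lemma segmentGradSup_nonneg (hθ : 0 < θ) (hp : ∀ v : Vec d, θ * ‖v‖ ≤ p v)
    (hf : Continuous (gradient f)) (x y : Vec d) : 0 ≤ segmentGradSup p f x y :=
  (dualNorm_nonneg hθ hp _).trans
    (dualNorm_gradient_le_segmentGradSup hθ hp hf x y (t := 0) (by simp))

/-- Gradient growth on a short step: the Lipschitz bound on the segment is solved for the
supremum of the gradient norm that occurs on both of its sides. -/
lemma segmentGradSup_le_of_step (hθ : 0 < θ) (hp : ∀ v : Vec d, θ * ‖v‖ ≤ p v)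
    (hf : Continuous (gradient f)) {L₀ L₁ η : ℝ} (hL₀ : 0 ≤ L₀) (hL₁ : 0 ≤ L₁)
    (hgrad : SymmLipschitzGradient p L₀ L₁ f) (hη : L₁ * η < 1) {x y : Vec d}
    (hxy : p (x - y) ≤ η) :
    segmentGradSup p f x y ≤ (dualNorm p (gradient f y) + L₀ * η) / (1 - L₁ * η) := by
  set s := segmentGradSup p f x y with hs
  have hs0 : 0 ≤ s := segmentGradSup_nonneg hθ hp hf x y
  have h : s ≤ dualNorm p (gradient f y) + (L₀ + L₁ * s) * η := by
    refine segmentGradSup_le fun t ht => ?_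
    set z := t • x + (1 - t) • y with hz
    have h1 := hgrad z y
    have h2 : segmentGradSup p f z y ≤ s := segmentGradSup_mono hθ hp hf x y ht
    have h3 : p (z - y) ≤ η := by
      have : z - y = t • (x - y) := by rw [hz]; module
      rw [this, map_smul_eq_mul, Real.norm_of_nonneg ht.1]
      exact (mul_le_of_le_one_left (apply_nonneg p _) ht.2).trans hxy
    have h4 : (L₀ + L₁ * segmentGradSup p f z y) * p (z - y) ≤ (L₀ + L₁ * s) * η := by
      gcongr
    linarith [dualNorm_sub_dualNorm_le hθ hp (gradient f z) (gradient f y)]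
  rw [le_div_iff₀ (by linarith)]
  linarith

/-- The second-order Taylor estimate for a function of one variable whose derivative exceeds its
initial value at most linearly. -/
lemma taylor_upper_bound {g g' : ℝ → ℝ} {C : ℝ} (hg : ∀ t, HasDerivAt g (g' t) t)
    (hC : ∀ t ∈ Set.Icc (0 : ℝ) 1, g' t - g' 0 ≤ C * t) : g 1 ≤ g 0 + g' 0 + C / 2 := by
  have hder : ∀ t, HasDerivAt (fun t => g t - g' 0 * t - C / 2 * t ^ 2)
      (g' t - g' 0 - C * t) t := fun t => by
    have := ((hg t).sub ((hasDerivAt_id t).const_mul (g' 0))).sub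
      ((hasDerivAt_pow 2 t).const_mul (C / 2))
    refine this.congr_deriv ?_
    simp only [mul_one, Nat.cast_ofNat]
    ring
  have hanti : AntitoneOn (fun t => g t - g' 0 * t - C / 2 * t ^ 2) (Set.Icc 0 1) := by
    refine antitoneOn_of_deriv_nonpos (convex_Icc 0 1)
      (fun t _ => (hder t).continuousAt.continuousWithinAt)
      (fun t _ => (hder t).differentiableAt.differentiableWithinAt) fun t ht => ?_
    rw [interior_Icc] at ht
    rw [(hder t).deriv]
    linarith [hC t ⟨ht.1.le, ht.2.le⟩]
  have := hanti (by simp : (0 : ℝ) ∈ Set.Icc (0 : ℝ) 1) (by simp : (1 : ℝ) ∈ Set.Icc (0 : ℝ) 1)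
    zero_le_one
  simp only at this
  linarith

lemma hasDerivAt_segment (x y : Vec d) (t : ℝ) :
    HasDerivAt (fun t : ℝ => t • x + (1 - t) • y) (x - y) t := by
  have h1 := (hasDerivAt_id t).smul_const x
  have h2 := ((hasDerivAt_id t).const_sub 1).smul_const y
  refine (h1.add h2).congr_deriv ?_
  module

lemma p_segment_sub {x y : Vec d} {t : ℝ} (ht : 0 ≤ t) :
    p (t • x + (1 - t) • y - y) = t * p (x - y) := by
  have : t • x + (1 - t) • y - y = t • (x - y) := by module
  rw [this, map_smul_eq_mul, Real.norm_of_nonneg ht]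

/-- The descent inequality, with the curvature constant of the whole segment. -/
lemma le_add_inner_gradient (hθ : 0 < θ) (hp : ∀ v : Vec d, θ * ‖v‖ ≤ p v)
    (hf : TwiceDifferentiable f) {L₀ L₁ : ℝ} (hL₁ : 0 ≤ L₁)
    (hgrad : SymmLipschitzGradient p L₀ L₁ f) (x y : Vec d) :
    f x ≤ f y + inner ℝ (gradient f y) (x - y)
      + (L₀ + L₁ * segmentGradSup p f x y) * p (x - y) ^ 2 / 2 := by
  have hder : ∀ t : ℝ, HasDerivAt (fun t : ℝ => f (t • x + (1 - t) • y))
      (inner ℝ (gradient f (t • x + (1 - t) • y)) (x - y)) t := fun t => by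
    have h1 := (hf.1 (t • x + (1 - t) • y)).hasGradientAt.hasFDerivAt
    exact h1.comp_hasDerivAt t (hasDerivAt_segment x y t)
  have := taylor_upper_bound hder
    (C := (L₀ + L₁ * segmentGradSup p f x y) * p (x - y) ^ 2) fun t ht => by
      have h1 := hgrad (t • x + (1 - t) • y) y
      have h2 := segmentGradSup_mono hθ hp hf.2.continuous x y ht
      rw [p_segment_sub ht.1] at h1
      have h0 := apply_nonneg p (x - y)
      simp only [zero_smul, sub_zero, one_smul, zero_add]
      rw [← inner_sub_left]
      calc _ ≤ dualNorm p (gradient f (t • x + (1 - t) • y) - gradient f y) * p (x - y) :=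
            inner_le_dualNorm_mul hθ hp _ _
        _ ≤ (L₀ + L₁ * segmentGradSup p f x y) * (t * p (x - y)) * p (x - y) := by
            refine mul_le_mul_of_nonneg_right (h1.trans ?_) h0
            have := mul_nonneg ht.1 h0
            gcongr
        _ = _ := by ring
  simpa using this

/-- The first-order Taylor estimate of the gradient, with the Hessian taken at `y`. -/
lemma dualNorm_gradient_taylor_le (hθ : 0 < θ) (hp : ∀ v : Vec d, θ * ‖v‖ ≤ p v)
    (hf : TwiceDifferentiable f) {M₀ M₁ : ℝ} (hM₁ : 0 ≤ M₁)
    (hhess : SymmLipschitzHessian p M₀ M₁ f) (x y : Vec d) :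
    dualNorm p (gradient f x - gradient f y - hessian f y (x - y)) ≤
      (M₀ + M₁ * segmentGradSup p f x y) * p (x - y) ^ 2 / 2 := by
  refine dualNorm_le_of_forall fun w hw => ?_
  have hder : ∀ t : ℝ, HasDerivAt (fun t : ℝ => inner ℝ (gradient f (t • x + (1 - t) • y)) w)
      (inner ℝ (hessian f (t • x + (1 - t) • y) (x - y)) w) t := fun t => by
    have h1 := (hf.2 (t • x + (1 - t) • y)).hasFDerivAt
    have h2 := (h1.comp_hasDerivAt t (hasDerivAt_segment x y t)).inner ℝ (hasDerivAt_const t w)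
    simpa [hessian] using h2
  have h0 := apply_nonneg p (x - y)
  have hs0 := segmentGradSup_nonneg hθ hp hf.2.continuous x y
  have := taylor_upper_bound hder
    (C := (M₀ + M₁ * segmentGradSup p f x y) * p (x - y) ^ 2) fun t ht => by
      have h1 := hhess (t • x + (1 - t) • y) y
      have h2 := segmentGradSup_mono hθ hp hf.2.continuous x y ht
      rw [p_segment_sub ht.1] at h1
      have ht0 := mul_nonneg ht.1 h0
      simp only [zero_smul, sub_zero, one_smul, zero_add]
      rw [← inner_sub_left, ← sub_apply]
      calc _ ≤ dualNorm p ((hessian f (t • x + (1 - t) • y) - hessian f y) (x - y)) :=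
            inner_le_dualNorm_of_le_one hθ hp _ hw
        _ ≤ _ := dualNorm_apply_le_opDualNorm hθ hp _ _
        _ ≤ (M₀ + M₁ * segmentGradSup p f x y) * (t * p (x - y)) * p (x - y) := by
            refine mul_le_mul_of_nonneg_right (h1.trans ?_) h0
            gcongr
        _ = _ := by ring
  simp only [zero_smul, sub_zero, one_smul, zero_add, sub_self, add_zero] at this
  rw [inner_sub_left, inner_sub_left]
  linarith

end Smoothness

/-! ### Joint measurability of stochastic gradients and Hessians -/

section Measurability

variable {d : ℕ} {Ξ : Type*} [MeasurableSpace Ξ] {F : Ξ → Vec d → ℝ}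

lemma measurable_gradient_sample (hFm : ∀ x, Measurable fun ξ => F ξ x)
    (hF : ∀ ξ, TwiceDifferentiable (F ξ)) (x : Vec d) :
    Measurable fun ξ => gradient (F ξ) x := by
  have key : ∀ v : Vec d, Measurable fun ξ => inner ℝ v (gradient (F ξ) x) := fun v => by
    refine measurable_of_tendsto_metrizable
      (f := fun (n : ℕ) ξ => (n : ℝ) • (F ξ (x + (n : ℝ)⁻¹ • v) - F ξ x))
      (fun n => ?_) (tendsto_pi_nhds.2 fun ξ => ?_)
    · have h1 := hFm (x + (n : ℝ)⁻¹ • v)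
      have h2 := hFm x
      fun_prop
    have h := ((hF ξ).1 x).hasGradientAt.hasFDerivAt.lim_real v
    rw [real_inner_comm]
    exact h.comp tendsto_natCast_atTop_atTop
  let b := EuclideanSpace.basisFun (Fin d) ℝ
  have : (fun ξ => gradient (F ξ) x) = fun ξ => ∑ i, inner ℝ (b i) (gradient (F ξ) x) • b i := by
    funext ξ
    exact (b.sum_repr' _).symm
  rw [this]
  exact Finset.measurable_sum _ fun i _ => (key (b i)).smul_const _

lemma measurable_gradient_uncurry (hFm : ∀ x, Measurable fun ξ => F ξ x)
    (hF : ∀ ξ, TwiceDifferentiable (F ξ)) :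
    Measurable fun q : Ξ × Vec d => gradient (F q.1) q.2 := by
  have h : Measurable (Function.uncurry fun (x : Vec d) (ξ : Ξ) => gradient (F ξ) x) :=
    measurable_uncurry_of_continuous_of_measurable (fun ξ => (hF ξ).2.continuous)
      (measurable_gradient_sample hFm hF)
  exact h.comp measurable_swap

/-- The Hessian need not be continuous; its joint measurability comes from the difference
quotients of the gradient. -/
lemma measurable_hessian_uncurry (hFm : ∀ x, Measurable fun ξ => F ξ x)
    (hF : ∀ ξ, TwiceDifferentiable (F ξ)) :
    Measurable fun q : Ξ × Vec d × Vec d => hessian (F q.1) q.2.1 q.2.2 := by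
  have hg := measurable_gradient_uncurry hFm hF
  refine measurable_of_tendsto_metrizable
    (f := fun (n : ℕ) (q : Ξ × Vec d × Vec d) => (n : ℝ) •
      (gradient (F q.1) (q.2.1 + (n : ℝ)⁻¹ • q.2.2) - gradient (F q.1) q.2.1))
    (fun n => ?_) (tendsto_pi_nhds.2 fun q => ?_)
  · have h1 := hg.comp (f := fun q : Ξ × Vec d × Vec d => (q.1, q.2.1 + (n : ℝ)⁻¹ • q.2.2))
      (by fun_prop)
    have h2 := hg.comp (f := fun q : Ξ × Vec d × Vec d => (q.1, q.2.1)) (by fun_prop)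
    simp only [Function.comp_def] at h1 h2
    fun_prop
  · exact (((hF q.1).2 q.2.1).hasFDerivAt.lim_real q.2.2).comp tendsto_natCast_atTop_atTop

lemma measurable_hessian_apply {f : Vec d → ℝ} (hf : TwiceDifferentiable f) :
    Measurable fun q : Vec d × Vec d => hessian f q.1 q.2 :=
  (measurable_hessian_uncurry (Ξ := Unit) (F := fun _ => f) (fun _ => measurable_const)
    (fun _ => hf)).comp (f := fun q : Vec d × Vec d => ((), q)) (by fun_prop)

end Measurability

/-! ### Second moments of discounted sums of fresh noise -/

section Noise

variable {d : ℕ} {Ξ Ω A : Type*} [MeasurableSpace Ξ] [MeasurableSpace Ω] [MeasurableSpace A]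
  {P : Measure Ω} {D : Measure Ξ}

/-- Averaging over a sample `X` that is independent of `Z` is integration against its law with
`Z` held fixed. -/
lemma integrable_and_integral_of_indepFun [IsProbabilityMeasure P] [IsProbabilityMeasure D]
    {Z : Ω → A} {X : Ω → Ξ} (hZ : Measurable Z) (hX : Measurable X) (hind : IndepFun Z X P)
    (hlaw : P.map X = D) {h : A × Ξ → ℝ} (hm : Measurable h) (h0 : ∀ q, 0 ≤ h q)
    (hint : ∀ a, Integrable (fun s => h (a, s)) D)
    (hZint : Integrable (fun ω => ∫ s, h (Z ω, s) ∂D) P) :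
    Integrable (fun ω => h (Z ω, X ω)) P ∧
      ∫ ω, h (Z ω, X ω) ∂P = ∫ ω, ∫ s, h (Z ω, s) ∂D ∂P := by
  have hmap : P.map (fun ω => (Z ω, X ω)) = (P.map Z).prod D := by
    rw [← hlaw]
    exact (indepFun_iff_map_prod_eq_prod_map_map hZ.aemeasurable hX.aemeasurable).1 hind
  have hZX : AEMeasurable (fun ω => (Z ω, X ω)) P := (hZ.prodMk hX).aemeasurable
  have : IsProbabilityMeasure (P.map Z) := Measure.isProbabilityMeasure_map hZ.aemeasurable
  have hI : StronglyMeasurable fun a => ∫ s, h (a, s) ∂D :=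
    hm.stronglyMeasurable.integral_prod_right'
  have hprod : Integrable h ((P.map Z).prod D) := by
    rw [integrable_prod_iff hm.aestronglyMeasurable]
    refine ⟨.of_forall hint, ?_⟩
    simp only [Real.norm_of_nonneg (h0 _)]
    rwa [integrable_map_measure hI.aestronglyMeasurable hZ.aemeasurable]
  constructor
  · rw [← hmap, integrable_map_measure hm.aestronglyMeasurable hZX] at hprod
    exact hprod
  · rw [← integral_map (f := h) hZX hm.aestronglyMeasurable, hmap, integral_prod _ hprod,
      integral_map hZ.aemeasurable hI.aestronglyMeasurable]

/-- The discounted sum of the noises `ψ (ξ (j+1)) (Z j)` for `j < k`, with discount factor `c`. -/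
def noiseSum (c : ℝ) (ψ : Ξ → A → Vec d) (ξ : ℕ → Ω → Ξ) (Z : ℕ → Ω → A) : ℕ → Ω → Vec d
  | 0 => fun _ => 0
  | k + 1 => fun ω => c • noiseSum c ψ ξ Z k ω + ψ (ξ (k + 1) ω) (Z k ω)

variable {ℱ : Filtration ℕ (inferInstance : MeasurableSpace Ω)} {c : ℝ} {ψ : Ξ → A → Vec d}
  {ξ : ℕ → Ω → Ξ} {Z : ℕ → Ω → A} {K : ℕ}

lemma measurable_noiseSum (hψ : Measurable fun q : Ξ × A => ψ q.1 q.2)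
    (hZ : ∀ k ≤ K, Measurable[ℱ k] (Z k)) (hξ : ∀ k ≤ K, Measurable[ℱ (k + 1)] (ξ (k + 1))) :
    ∀ k ≤ K + 1, Measurable[ℱ k] (noiseSum c ψ ξ Z k) := by
  intro k
  induction k with
  | zero => intro _; exact measurable_const
  | succ k ih =>
    intro hk
    have hk' : k ≤ K := by omega
    have h1 : Measurable[ℱ (k + 1)] (noiseSum c ψ ξ Z k) :=
      (ih (by omega)).mono (ℱ.mono k.le_succ) le_rfl
    have h2 : Measurable[ℱ (k + 1)] (Z k) := (hZ k hk').mono (ℱ.mono k.le_succ) le_rfl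
    exact (h1.const_smul c).add (hψ.comp ((hξ k hk').prodMk h2))

/-- With centred noises of second moment at most `C ^ 2`, each fresh given the past, the cross
terms vanish and the second moment obeys `E ↦ (1 - α) ^ 2 E + C ^ 2`, under which `C ^ 2 / α` is
preserved. -/
lemma integrable_and_integral_sq_noiseSum_le [IsProbabilityMeasure P] [IsProbabilityMeasure D]
    {α C : ℝ} (hα : 0 < α) (hα1 : α ≤ 1) (hψ : Measurable fun q : Ξ × A => ψ q.1 q.2)
    (hψi : ∀ a, Integrable (fun s => ψ s a) D) (hmean : ∀ a, ∫ s, ψ s a ∂D = 0)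
    (hsq : ∀ a, Integrable (fun s => ‖ψ s a‖ ^ 2) D)
    (hZ : ∀ k ≤ K, Measurable[ℱ k] (Z k)) (hξ : ∀ k ≤ K, Measurable[ℱ (k + 1)] (ξ (k + 1)))
    (hlaw : ∀ k ≤ K, P.map (ξ (k + 1)) = D)
    (hind : ∀ k ≤ K, Indep (MeasurableSpace.comap (ξ (k + 1)) inferInstance) (ℱ k) P)
    (hC : ∀ k ≤ K, ∀ ω, ∫ s, ‖ψ s (Z k ω)‖ ^ 2 ∂D ≤ C ^ 2) :
    ∀ k ≤ K + 1, Integrable (fun ω => ‖noiseSum (1 - α) ψ ξ Z k ω‖ ^ 2) P ∧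
      ∫ ω, ‖noiseSum (1 - α) ψ ξ Z k ω‖ ^ 2 ∂P ≤ C ^ 2 / α := by
  intro k
  induction k with
  | zero => intro _; simp [noiseSum]; positivity
  | succ k ih =>
    intro hk
    have hk' : k ≤ K := by omega
    obtain ⟨ihi, ihb⟩ := ih (by omega)
    set S := noiseSum (1 - α) ψ ξ Z k with hS
    have hSm : Measurable[ℱ k] S := measurable_noiseSum hψ hZ hξ k (by omega)
    have hYm : Measurable[ℱ k] fun ω => (S ω, Z k ω) := hSm.prodMk (hZ k hk')
    have hindep : IndepFun (fun ω => (S ω, Z k ω)) (ξ (k + 1)) P := by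
      rw [IndepFun_iff_Indep]
      exact (indep_of_indep_of_le_right (hind k hk') hYm.comap_le).symm
    have hexp : ∀ (a : Vec d × A), (fun s => ‖(1 - α) • a.1 + ψ s a.2‖ ^ 2) =
        fun s => (1 - α) ^ 2 * ‖a.1‖ ^ 2 + 2 * (1 - α) * inner ℝ a.1 (ψ s a.2)
          + ‖ψ s a.2‖ ^ 2 := fun a => by
      funext s
      rw [norm_add_sq_real, norm_smul, mul_pow, Real.norm_eq_abs, sq_abs, real_inner_smul_left]
      ring
    have hint1 : ∀ a : Vec d × A,
        Integrable (fun s => 2 * (1 - α) * inner ℝ a.1 (ψ s a.2)) D :=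
      fun a => ((hψi a.2).const_inner a.1).const_mul _
    have hint : ∀ a : Vec d × A, Integrable (fun s => ‖(1 - α) • a.1 + ψ s a.2‖ ^ 2) D :=
      fun a => by
        rw [hexp]
        exact ((integrable_const _).add (hint1 a)).add (hsq a.2)
    have hval : ∀ a : Vec d × A, ∫ s, ‖(1 - α) • a.1 + ψ s a.2‖ ^ 2 ∂D =
        (1 - α) ^ 2 * ‖a.1‖ ^ 2 + ∫ s, ‖ψ s a.2‖ ^ 2 ∂D := fun a => by
      have h12 : Integrable (fun s => (1 - α) ^ 2 * ‖a.1‖ ^ 2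
          + 2 * (1 - α) * inner ℝ a.1 (ψ s a.2)) D := (integrable_const _).add (hint1 a)
      rw [hexp, integral_add h12 (hsq a.2), integral_add (integrable_const _) (hint1 a),
        integral_const_mul (2 * (1 - α)), integral_inner (hψi a.2), hmean]
      simp
    have hV : StronglyMeasurable fun a => ∫ s, ‖ψ s a‖ ^ 2 ∂D := by
      have : Measurable fun q : A × Ξ => ‖ψ q.2 q.1‖ ^ 2 :=
        (hψ.comp measurable_swap).norm.pow_const 2
      exact this.stronglyMeasurable.integral_prod_right'
    have hVi : Integrable (fun ω => ∫ s, ‖ψ s (Z k ω)‖ ^ 2 ∂D) P := by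
      refine (integrable_const (C ^ 2)).mono'
        (hV.measurable.comp ((hZ k hk').mono (ℱ.le k) le_rfl)).aestronglyMeasurable
        (.of_forall fun ω => ?_)
      rw [Real.norm_of_nonneg (integral_nonneg fun s => sq_nonneg _)]
      exact hC k hk' ω
    have hZint : Integrable (fun ω => (1 - α) ^ 2 * ‖S ω‖ ^ 2 + ∫ s, ‖ψ s (Z k ω)‖ ^ 2 ∂D) P :=
      (ihi.const_mul _).add hVi
    have hvalω : ∀ ω, ∫ s, ‖(1 - α) • S ω + ψ s (Z k ω)‖ ^ 2 ∂D =
        (1 - α) ^ 2 * ‖S ω‖ ^ 2 + ∫ s, ‖ψ s (Z k ω)‖ ^ 2 ∂D := fun ω => hval (S ω, Z k ω)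
    have hm : Measurable fun q : (Vec d × A) × Ξ => ‖(1 - α) • q.1.1 + ψ q.2 q.1.2‖ ^ 2 := by
      have h1 : Measurable fun q : (Vec d × A) × Ξ => ψ q.2 q.1.2 :=
        hψ.comp (f := fun q : (Vec d × A) × Ξ => (q.2, q.1.2)) (by fun_prop)
      fun_prop
    have hmain := integrable_and_integral_of_indepFun
      (hYm.mono (ℱ.le k) le_rfl) ((hξ k hk').mono (ℱ.le _) le_rfl) hindep (hlaw k hk') hm
      (fun q => sq_nonneg _) hint (by simpa only [hvalω] using hZint)
    refine ⟨hmain.1, hmain.2.le.trans ?_⟩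
    simp only [hvalω]
    rw [integral_add (ihi.const_mul _) hVi, integral_const_mul]
    have h1 : ∫ ω, ∫ s, ‖ψ s (Z k ω)‖ ^ 2 ∂D ∂P ≤ C ^ 2 := by
      simpa using integral_mono hVi (integrable_const (C ^ 2)) (hC k hk')
    have h2 : (1 - α) ^ 2 * (C ^ 2 / α) + C ^ 2 = C ^ 2 / α - (1 - α) * C ^ 2 := by
      field_simp
      ring
    nlinarith [mul_le_mul_of_nonneg_left ihb (sq_nonneg (1 - α)),
      mul_nonneg (sub_nonneg.2 hα1) (sq_nonneg C)]

lemma integrable_and_integral_norm_le_of_sq [IsProbabilityMeasure P] {S : Ω → Vec d} {b : ℝ}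
    (hS : Measurable S) (hb : 0 ≤ b) (hi : Integrable (fun ω => ‖S ω‖ ^ 2) P)
    (hle : ∫ ω, ‖S ω‖ ^ 2 ∂P ≤ b ^ 2) :
    Integrable (fun ω => ‖S ω‖) P ∧ ∫ ω, ‖S ω‖ ∂P ≤ b := by
  have hL : MemLp (fun ω => ‖S ω‖) 2 P :=
    (memLp_two_iff_integrable_sq hS.norm.aestronglyMeasurable).2 hi
  refine ⟨hL.integrable (by norm_num), ?_⟩
  have h := variance_nonneg (fun ω => ‖S ω‖) P
  rw [variance_eq_sub hL] at h
  refine (le_abs_self _).trans (abs_le_of_sq_le_sq ?_ hb)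
  have h2 : ∫ ω, ((fun ω => ‖S ω‖) ^ 2) ω ∂P = ∫ ω, ‖S ω‖ ^ 2 ∂P := rfl
  linarith

end Noise

/-! ### The step size -/

section StepSize

variable {L₁ M₁ : ℝ}

lemma etaHat_pos_and_mul_le (hL₁ : 0 ≤ L₁) (hM₁ : 0 ≤ M₁) (hLM : L₁ ≠ 0 ∨ M₁ ≠ 0) :
    0 < etaHat L₁ M₁ ∧ L₁ * etaHat L₁ M₁ ≤ 1 / 3 ∧ M₁ * etaHat L₁ M₁ ^ 2 ≤ 1 / 9 := by
  unfold etaHat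
  set μ := min (ENNReal.ofReal L₁)⁻¹ (ENNReal.ofReal (√M₁))⁻¹ with hμ
  have h0 : μ ≠ 0 := by
    simp only [hμ, ne_eq, ← bot_eq_zero, min_eq_bot, not_or]
    simp
  -- One of the two reciprocals is finite because `L₁` and `M₁` do not both vanish.
  have htop : μ ≠ ⊤ := by
    rw [hμ, ne_eq, min_eq_top, ENNReal.inv_eq_top, ENNReal.inv_eq_top, ENNReal.ofReal_eq_zero,
      ENNReal.ofReal_eq_zero, Real.sqrt_le_left le_rfl]
    rintro ⟨h1, h2⟩
    rcases hLM with h | h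
    · exact h (le_antisymm h1 hL₁)
    · exact h (le_antisymm (by simpa using h2) hM₁)
  have key : ∀ c : ℝ, 0 ≤ c → μ ≤ (ENNReal.ofReal c)⁻¹ → c * μ.toReal ≤ 1 := fun c hc hle => by
    have h : ENNReal.ofReal c * μ ≤ 1 :=
      (mul_le_mul_right hle _).trans (ENNReal.mul_inv_le_one _)
    have := ENNReal.toReal_mono ENNReal.one_ne_top h
    rwa [ENNReal.toReal_mul, ENNReal.toReal_ofReal hc, ENNReal.toReal_one] at this
  have hpos : 0 < μ.toReal := ENNReal.toReal_pos h0 htop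
  have hL := key L₁ hL₁ (min_le_left _ _)
  have hM := key (√M₁) (Real.sqrt_nonneg _) (min_le_right _ _)
  refine ⟨by positivity, by linarith, ?_⟩
  have h2 : (√M₁ * μ.toReal) ^ 2 ≤ 1 := pow_le_one₀ (by positivity) hM
  rw [mul_pow, Real.sq_sqrt hM₁] at h2
  linarith

end StepSize

/-! ### The one-step inequality along a trajectory -/

section Trajectory

variable {d : ℕ} {p : Seminorm ℝ (Vec d)} {θ : ℝ} {f : Vec d → ℝ}

/-- One step of the method for a fixed sample path. The quantity `f x / η + (2 / α) ‖E‖_*` is a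
potential; `S` is the accumulated sampling noise in the momentum and `E` the remaining momentum
error. The terms proportional to the gradient norm that are produced by `L₁` and `M₁` are at most
half of the gradient norm and have been absorbed in the left side. -/
lemma half_dualNorm_gradient_le (hθ : 0 < θ) (hp : ∀ v : Vec d, θ * ‖v‖ ≤ p v) {ρ : ℝ}
    (hρ : ∀ v : Vec d, dualNorm p v ≤ ρ * ‖v‖) (hf : TwiceDifferentiable f)
    {L₀ L₁ M₀ M₁ η α q : ℝ} (hL₀ : 0 ≤ L₀) (hL₁ : 0 ≤ L₁) (hM₀ : 0 ≤ M₀) (hM₁ : 0 ≤ M₁)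
    (hgrad : SymmLipschitzGradient p L₀ L₁ f) (hhess : SymmLipschitzHessian p M₀ M₁ f)
    (hη : 0 < η) (hα : 0 < α) (hα1 : α ≤ 1) (hLη : L₁ * η ≤ 2 / 9)
    (hMη : M₁ * η ^ 2 ≤ 2 / 27 * α) (hq : q * (1 - L₁ * η) = 1)
    {x x' m S E' : Vec d} (hstep : x' - x ∈ lmo p η m)
    (hE' : E' = (1 - α) • ((m - gradient f x - S)
      + (gradient f x - gradient f x' - hessian f x' (x - x')))) :
    dualNorm p (gradient f x) / 2 ≤ (f x - f x') / η
      + 2 / α * (dualNorm p (m - gradient f x - S) - dualNorm p E')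
      + 2 * ρ * ‖S‖ + η ^ 2 / α * (M₀ + M₁ * (L₀ * η * q)) + η * q * L₀ / 2 := by
  have hcont := hf.2.continuous
  set G := dualNorm p (gradient f x) with hG
  set s := segmentGradSup p f x' x with hs
  set E := m - gradient f x - S with hE
  have hG0 : 0 ≤ G := dualNorm_nonneg hθ hp _
  have hs0 : 0 ≤ s := segmentGradSup_nonneg hθ hp hcont _ _
  have hpv : p (x' - x) ≤ η := hstep.1
  have hpv0 : 0 ≤ p (x' - x) := apply_nonneg p _
  have hpv2 : p (x' - x) ^ 2 ≤ η ^ 2 := by gcongr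
  have hq0 : 0 < q := by
    by_contra! h
    nlinarith
  have hq1 : q ≤ 9 / 7 := by nlinarith
  have hsle : s ≤ (G + L₀ * η) * q := by
    have h := segmentGradSup_le_of_step hθ hp hcont hL₀ hL₁ hgrad (by linarith) hpv
    have hq' : (1 - L₁ * η)⁻¹ = q := inv_eq_of_mul_eq_one_left hq
    rwa [div_eq_mul_inv, hq'] at h
  -- Descent: the momentum `m` replaces the gradient at the cost of twice its error.
  have hdesc : η * G ≤ f x - f x' + 2 * η * dualNorm p (m - gradient f x)
      + (L₀ + L₁ * s) * η ^ 2 / 2 := by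
    have h1 := le_add_inner_gradient hθ hp hf hL₁ hgrad x' x
    have h2 : (L₀ + L₁ * s) * p (x' - x) ^ 2 ≤ (L₀ + L₁ * s) * η ^ 2 := by gcongr
    have h3 := inner_le_of_mem_lmo hη hstep
    have h4 := inner_le_dualNorm_mul hθ hp (gradient f x - m) (x' - x)
    have h5 : dualNorm p (gradient f x - m) ≤ dualNorm p (m - gradient f x) := by
      simpa using dualNorm_neg_le hθ hp (m - gradient f x)
    have h6 := dualNorm_sub_dualNorm_le hθ hp (gradient f x) m
    have h7 : dualNorm p (gradient f x - m) * p (x' - x) ≤ dualNorm p (m - gradient f x) * η :=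
      mul_le_mul h5 hpv hpv0 (dualNorm_nonneg hθ hp _)
    rw [inner_sub_left] at h4
    have h8 : η * (G - dualNorm p m) ≤ η * dualNorm p (m - gradient f x) :=
      mul_le_mul_of_nonneg_left (h6.trans h5) hη.le
    linarith
  have hdesc' : G ≤ (f x - f x') / η + 2 * dualNorm p (m - gradient f x)
      + (L₀ + L₁ * s) * η / 2 := by
    have : G = η * G / η := by field_simp
    rw [this, div_le_iff₀ hη]
    have h9 : (f x - f x') / η * η = f x - f x' := by field_simp
    linarith
  have hnoise : dualNorm p (m - gradient f x) ≤ dualNorm p E + ρ * ‖S‖ := by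
    have h := dualNorm_add_le hθ hp E S
    rw [hE, sub_add_cancel] at h
    linarith [hρ S]
  -- The momentum error contracts by the factor `1 - α`, up to a Taylor remainder.
  have hmom : dualNorm p E' ≤ (1 - α) * dualNorm p E + (M₀ + M₁ * s) * η ^ 2 / 2 := by
    have h1 := dualNorm_gradient_taylor_le hθ hp hf hM₁ hhess x x'
    rw [segmentGradSup_comm, ← hs, map_sub_rev p x x'] at h1
    have h2 : (M₀ + M₁ * s) * p (x' - x) ^ 2 ≤ (M₀ + M₁ * s) * η ^ 2 := by gcongr
    have h3 := dualNorm_smul_le hθ hp (sub_nonneg.2 hα1)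
      (E + (gradient f x - gradient f x' - hessian f x' (x - x')))
    rw [← hE'] at h3
    have h4 := dualNorm_add_le hθ hp E (gradient f x - gradient f x' - hessian f x' (x - x'))
    have h5 := mul_le_mul_of_nonneg_left h4 (sub_nonneg.2 hα1)
    have h6 : (1 - α) * dualNorm p (gradient f x - gradient f x' - hessian f x' (x - x')) ≤
        dualNorm p (gradient f x - gradient f x' - hessian f x' (x - x')) :=
      mul_le_of_le_one_left (dualNorm_nonneg hθ hp _) (by linarith)
    linarith
  have hmom' : 2 * dualNorm p E ≤ 2 / α * (dualNorm p E - dualNorm p E')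
      + η ^ 2 / α * (M₀ + M₁ * s) := by
    have h1 : 2 / α * (dualNorm p E - dualNorm p E') + η ^ 2 / α * (M₀ + M₁ * s)
        = (2 * (dualNorm p E - dualNorm p E') + η ^ 2 * (M₀ + M₁ * s)) / α := by ring
    rw [h1, le_div_iff₀ hα]
    linarith
  have hcurvL : (L₀ + L₁ * s) * η / 2 ≤ η * q * L₀ / 2 + G / 7 := by
    have h1 : L₁ * s * η ≤ L₁ * ((G + L₀ * η) * q) * η := by gcongr
    have h2 : G * (L₁ * η * q) ≤ G * (2 / 7) :=
      mul_le_mul_of_nonneg_left (by linarith) hG0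
    have h3 : L₀ * η * (q * (1 - L₁ * η)) = L₀ * η := by rw [hq, mul_one]
    linarith
  have hcurvM : η ^ 2 / α * (M₀ + M₁ * s) ≤
      η ^ 2 / α * (M₀ + M₁ * (L₀ * η * q)) + 2 / 21 * G := by
    have h1 : η ^ 2 / α * (M₀ + M₁ * s) ≤ η ^ 2 / α * (M₀ + M₁ * ((G + L₀ * η) * q)) := by
      gcongr
    have h2 : M₁ * η ^ 2 / α ≤ 2 / 27 := by rwa [div_le_iff₀ hα]
    have h3 : M₁ * η ^ 2 / α * (q * G) ≤ 2 / 27 * (9 / 7 * G) := by gcongr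
    have h4 : η ^ 2 / α * (M₀ + M₁ * ((G + L₀ * η) * q)) =
        η ^ 2 / α * (M₀ + M₁ * (L₀ * η * q)) + M₁ * η ^ 2 / α * (q * G) := by ring
    linarith
  linarith

/-- The one-step inequality summed over a sample path. -/
lemma sum_half_dualNorm_gradient_le (hθ : 0 < θ) (hp : ∀ v : Vec d, θ * ‖v‖ ≤ p v) {ρ : ℝ}
    (hρ : ∀ v : Vec d, dualNorm p v ≤ ρ * ‖v‖) (hf : TwiceDifferentiable f)
    (hbdd : BddBelow (Set.range f))
    {L₀ L₁ M₀ M₁ η α q : ℝ} (hL₀ : 0 ≤ L₀) (hL₁ : 0 ≤ L₁) (hM₀ : 0 ≤ M₀) (hM₁ : 0 ≤ M₁)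
    (hgrad : SymmLipschitzGradient p L₀ L₁ f) (hhess : SymmLipschitzHessian p M₀ M₁ f)
    (hη : 0 < η) (hα : 0 < α) (hα1 : α ≤ 1) (hLη : L₁ * η ≤ 2 / 9)
    (hMη : M₁ * η ^ 2 ≤ 2 / 27 * α) (hq : q * (1 - L₁ * η) = 1)
    {N : ℕ} {x m S : ℕ → Vec d} (hS : S 0 = 0)
    (hstep : ∀ k < N, x (k + 1) - x k ∈ lmo p η (m k))
    (hE : ∀ k < N, m (k + 1) - gradient f (x (k + 1)) - S (k + 1) =
      (1 - α) • ((m k - gradient f (x k) - S k) + (gradient f (x k) - gradient f (x (k + 1))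
        - hessian f (x (k + 1)) (x k - x (k + 1))))) :
    ∑ k ∈ Finset.range N, dualNorm p (gradient f (x k)) / 2 ≤ (f (x 0) - ⨅ y, f y) / η
      + 2 / α * dualNorm p (m 0 - gradient f (x 0))
      + ∑ k ∈ Finset.range N, 2 * ρ * ‖S k‖
      + N * (η ^ 2 / α * (M₀ + M₁ * (L₀ * η * q)) + η * q * L₀ / 2) := by
  have hsum := Finset.sum_le_sum fun k (hk : k ∈ Finset.range N) =>
    half_dualNorm_gradient_le hθ hp hρ hf hL₀ hL₁ hM₀ hM₁ hgrad hhess hη hα hα1 hLη hMη hq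
      (hstep k (Finset.mem_range.1 hk)) (hE k (Finset.mem_range.1 hk))
  simp only [Finset.sum_add_distrib, Finset.sum_const, Finset.card_range, nsmul_eq_mul,
    ← Finset.sum_div, ← Finset.mul_sum] at hsum ⊢
  rw [Finset.sum_range_sub' (fun k => f (x k)),
    Finset.sum_range_sub' (fun k => dualNorm p (m k - gradient f (x k) - S k)), hS,
    sub_zero] at hsum
  have h1 : (f (x 0) - f (x N)) / η ≤ (f (x 0) - ⨅ y, f y) / η := by
    gcongr
    exact ciInf_le hbdd _
  have h2 : 2 / α * (dualNorm p (m 0 - gradient f (x 0))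
      - dualNorm p (m N - gradient f (x N) - S N)) ≤
      2 / α * dualNorm p (m 0 - gradient f (x 0)) := by
    have := dualNorm_nonneg hθ hp (m N - gradient f (x N) - S N)
    gcongr
    linarith
  linarith

end Trajectory

/-! ### The method on random samples -/

section Run

variable {d : ℕ} {Ξ Ω : Type*} [MeasurableSpace Ξ] [MeasurableSpace Ω] {P : Measure Ω}
  {D : Measure Ξ} {F : Ξ → Vec d → ℝ} {f : Vec d → ℝ} {p : Seminorm ℝ (Vec d)} {θ : ℝ}
  {ℱ : Filtration ℕ (inferInstance : MeasurableSpace Ω)} {η α β : ℕ → ℝ} {K : ℕ} {x₀ : Vec d}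
  {ξ : ℕ → Ω → Ξ} {x m : ℕ → Ω → Vec d}

namespace IsSecondOrderMomentumRun

lemma measurable_point (hrun : IsSecondOrderMomentumRun P D F p ℱ η α β K x₀ ξ x m) {k : ℕ}
    (hk : k ≤ K + 1) : Measurable[ℱ k] (x k) := by
  cases k with
  | zero =>
    rw [show x 0 = fun _ => x₀ from funext hrun.init_point]
    exact measurable_const
  | succ k => exact (hrun.point_measurable k (by omega)).mono (ℱ.mono k.le_succ) le_rfl

lemma norm_step_le (hrun : IsSecondOrderMomentumRun P D F p ℱ η α β K x₀ ξ x m) (hθ : 0 < θ)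
    (hp : ∀ v : Vec d, θ * ‖v‖ ≤ p v) {k : ℕ} (hk : k ≤ K) (ω : Ω) :
    ‖x (k + 1) ω - x k ω‖ ≤ η k / θ := by
  rw [le_div_iff₀ hθ, mul_comm]
  exact (hp _).trans (hrun.point_step k hk ω).1

/-- Each iterate stays in a fixed ball, on which the continuous function `g` is bounded. -/
lemma integrable_comp_point [IsProbabilityMeasure P]
    (hrun : IsSecondOrderMomentumRun P D F p ℱ η α β K x₀ ξ x m) (hθ : 0 < θ)
    (hp : ∀ v : Vec d, θ * ‖v‖ ≤ p v) {g : Vec d → ℝ} (hg : Continuous g) {k : ℕ}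
    (hk : k ≤ K + 1) : Integrable (fun ω => g (x k ω)) P := by
  have hball : ∃ R : ℝ, ∀ ω, ‖x k ω‖ ≤ R := by
    induction k with
    | zero => exact ⟨‖x₀‖, fun ω => (congrArg norm (hrun.init_point ω)).le⟩
    | succ k ih =>
      obtain ⟨R, hR⟩ := ih (by omega)
      refine ⟨R + η k / θ, fun ω => ?_⟩
      have h1 := hrun.norm_step_le hθ hp (show k ≤ K by omega) ω
      have h2 := norm_sub_norm_le (x (k + 1) ω) (x k ω)
      linarith [hR ω]
  obtain ⟨R, hR⟩ := hball
  obtain ⟨B, hB⟩ := (isCompact_closedBall (0 : Vec d) R).exists_bound_of_continuousOn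
    hg.continuousOn
  refine (integrable_const B).mono'
    (hg.measurable.comp ((hrun.measurable_point hk).mono (ℱ.le k) le_rfl)).aestronglyMeasurable
    (.of_forall fun ω => hB _ ?_)
  simpa using hR ω

end IsSecondOrderMomentumRun

/-- The contribution of the gradient sample at `a.1` to the momentum error. -/
noncomputable def gradientNoise (F : Ξ → Vec d → ℝ) (f : Vec d → ℝ) (α : ℝ) (s : Ξ)
    (a : Vec d × Vec d) : Vec d :=
  α • (gradient (F s) a.1 - gradient f a.1)

/-- The contribution of the Hessian sample at `a.1`, applied to the step `a.2`, to the momentum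
error. -/
noncomputable def hessianNoise (F : Ξ → Vec d → ℝ) (f : Vec d → ℝ) (α : ℝ) (s : Ξ)
    (a : Vec d × Vec d) : Vec d :=
  (1 - α) • (hessian (F s) a.1 - hessian f a.1) a.2

/-- The point at which the sample `ξ (k+1)` is used, and the step that led there. -/
def pointAndStep (x : ℕ → Ω → Vec d) (k : ℕ) (ω : Ω) : Vec d × Vec d :=
  (x (k + 1) ω, x (k + 1) ω - x k ω)

lemma measurable_gradientNoise (hF : IsStochasticObjective D F f) (hf : TwiceDifferentiable f)
    (α : ℝ) : Measurable fun q : Ξ × Vec d × Vec d => gradientNoise F f α q.1 q.2 := by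
  have h1 := (measurable_gradient_uncurry hF.measurable hF.twiceDifferentiable).comp
    (f := fun q : Ξ × Vec d × Vec d => (q.1, q.2.1)) (by fun_prop)
  have h2 : Measurable (gradient f) := hf.2.continuous.measurable
  simp only [Function.comp_def] at h1
  unfold gradientNoise
  fun_prop

lemma measurable_hessianNoise (hF : IsStochasticObjective D F f) (hf : TwiceDifferentiable f)
    (α : ℝ) : Measurable fun q : Ξ × Vec d × Vec d => hessianNoise F f α q.1 q.2 := by
  have h1 := measurable_hessian_uncurry hF.measurable hF.twiceDifferentiable
  have h2 := (measurable_hessian_apply hf).comp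
    (f := fun q : Ξ × Vec d × Vec d => q.2) (by fun_prop)
  simp only [Function.comp_def] at h2
  simp only [hessianNoise, sub_apply]
  fun_prop

variable {σg σH : ℝ}

lemma integral_sq_norm_smul (c : ℝ) (g : Ξ → Vec d) :
    ∫ s, ‖c • g s‖ ^ 2 ∂D = c ^ 2 * ∫ s, ‖g s‖ ^ 2 ∂D := by
  simp only [norm_smul, mul_pow, Real.norm_eq_abs, sq_abs, integral_const_mul]

lemma integrable_sq_norm_smul (c : ℝ) {g : Ξ → Vec d} (hg : Integrable (fun s => ‖g s‖ ^ 2) D) :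
    Integrable (fun s => ‖c • g s‖ ^ 2) D := by
  simp only [norm_smul, mul_pow]
  exact hg.const_mul _

namespace UnbiasedBoundedVariance

lemma integrable_gradientNoise [IsProbabilityMeasure D]
    (hvar : UnbiasedBoundedVariance D F f σg σH) (α : ℝ) (a : Vec d × Vec d) :
    Integrable (fun s => gradientNoise F f α s a) D ∧ ∫ s, gradientNoise F f α s a ∂D = 0 ∧
      Integrable (fun s => ‖gradientNoise F f α s a‖ ^ 2) D ∧
      ∫ s, ‖gradientNoise F f α s a‖ ^ 2 ∂D ≤ (α * σg) ^ 2 := by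
  unfold gradientNoise
  have hi := hvar.grad_integrable a.1
  refine ⟨(hi.sub (integrable_const _)).smul α, ?_,
    integrable_sq_norm_smul α (hvar.grad_sq_integrable a.1), ?_⟩
  · rw [integral_smul, integral_sub hi (integrable_const _), hvar.grad_mean]
    simp
  · rw [integral_sq_norm_smul, mul_pow]
    exact mul_le_mul_of_nonneg_left (hvar.grad_variance a.1) (sq_nonneg α)

lemma integrable_hessianNoise [IsProbabilityMeasure D]
    (hvar : UnbiasedBoundedVariance D F f σg σH) {α : ℝ} (hα : 0 ≤ α) (hα1 : α ≤ 1)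
    (a : Vec d × Vec d) :
    Integrable (fun s => hessianNoise F f α s a) D ∧ ∫ s, hessianNoise F f α s a ∂D = 0 ∧
      Integrable (fun s => ‖hessianNoise F f α s a‖ ^ 2) D ∧
      ∫ s, ‖hessianNoise F f α s a‖ ^ 2 ∂D ≤ σH ^ 2 * ‖a.2‖ ^ 2 := by
  unfold hessianNoise
  have hi := hvar.hess_integrable a.1
  have hi' : Integrable (fun s => hessian (F s) a.1 - hessian f a.1) D :=
    hi.sub (integrable_const _)
  refine ⟨(hi'.apply_continuousLinearMap a.2).smul (1 - α), ?_,
    integrable_sq_norm_smul (1 - α) (hvar.hess_sq_integrable a.1 a.2), ?_⟩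
  · rw [integral_smul, ← ContinuousLinearMap.integral_apply hi',
      integral_sub hi (integrable_const _), hvar.hess_mean]
    simp
  · rw [integral_sq_norm_smul]
    have h1 : (1 - α) ^ 2 ≤ 1 := pow_le_one₀ (by linarith) (by linarith)
    have h2 := hvar.hess_variance a.1 a.2
    exact (mul_le_of_le_one_left (integral_nonneg fun s => sq_nonneg _) h1).trans h2

end UnbiasedBoundedVariance

/-- The momentum error, stripped of the accumulated noise, is contracted and receives only the
Taylor remainder of the gradient. -/
lemma momentum_error_step {η α : ℝ} (hα1 : α < 1)
    (hrun : IsSecondOrderMomentumRun P D F p ℱ (fun _ => η) (fun _ => α) (fun _ => 1 - α) K x₀ ξ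
      x m) {k : ℕ} (hk : k ≤ K) (ω : Ω) :
    let S := fun k => noiseSum (1 - α) (gradientNoise F f α) ξ (pointAndStep x) k ω
      + noiseSum (1 - α) (hessianNoise F f α) ξ (pointAndStep x) k ω
    m (k + 1) ω - gradient f (x (k + 1) ω) - S (k + 1) =
      (1 - α) • ((m k ω - gradient f (x k ω) - S k) + (gradient f (x k ω)
        - gradient f (x (k + 1) ω) - hessian f (x (k + 1) ω) (x k ω - x (k + 1) ω))) := by
  intro S
  have h1 : (1 - α) / (1 - α) = 1 := div_self (by linarith)
  simp only [S, noiseSum, gradientNoise, hessianNoise, pointAndStep, sub_apply,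
    hrun.momentum_step k hk ω, h1, ← neg_sub (x (k + 1) ω) (x k ω), map_neg]
  module

/-- Averaging the summed one-step inequality over the samples. With `r = √α`, the noise sums have
mean norm at most `r σg` (gradients) and `σH (η / θ) / r` (Hessians). -/
lemma sum_integral_half_dualNorm_gradient_le [IsProbabilityMeasure P] [IsProbabilityMeasure D]
    (hθ : 0 < θ) (hp : ∀ v : Vec d, θ * ‖v‖ ≤ p v) {ρ : ℝ} (hρ0 : 0 ≤ ρ)
    (hρ : ∀ v : Vec d, dualNorm p v ≤ ρ * ‖v‖) {L₀ L₁ M₀ M₁ η α q r : ℝ}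
    (hσg : 0 ≤ σg) (hσH : 0 ≤ σH)
    (hL₀ : 0 ≤ L₀) (hL₁ : 0 ≤ L₁) (hM₀ : 0 ≤ M₀) (hM₁ : 0 ≤ M₁)
    (hF : IsStochasticObjective D F f) (hf : TwiceDifferentiable f)
    (hvar : UnbiasedBoundedVariance D F f σg σH) (hbdd : BddBelow (Set.range f))
    (hgrad : SymmLipschitzGradient p L₀ L₁ f) (hhess : SymmLipschitzHessian p M₀ M₁ f)
    (hη : 0 < η) (hr : 0 < r) (hrα : r ^ 2 = α) (hα1 : α < 1) (hLη : L₁ * η ≤ 2 / 9)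
    (hMη : M₁ * η ^ 2 ≤ 2 / 27 * α) (hq : q * (1 - L₁ * η) = 1)
    (hrun : IsSecondOrderMomentumRun P D F p ℱ (fun _ => η) (fun _ => α) (fun _ => 1 - α) K x₀ ξ
      x m) (hm₀ : Integrable (m 0) P) :
    ∑ k ∈ Finset.range (K + 1), ∫ ω, dualNorm p (gradient f (x k ω)) / 2 ∂P ≤
      (f x₀ - ⨅ y, f y) / η
      + 2 / α * ∫ ω, dualNorm p (m 0 ω - gradient f (x 0 ω)) ∂P
      + ((K + 1 : ℕ) : ℝ) * (2 * ρ * (r * σg + σH * (η / θ) / r))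
      + ((K + 1 : ℕ) : ℝ) * (η ^ 2 / α * (M₀ + M₁ * (L₀ * η * q)) + η * q * L₀ / 2) := by
  have hα : 0 < α := hrα ▸ pow_pos hr 2
  set Sg := noiseSum (1 - α) (gradientNoise F f α) ξ (pointAndStep x) with hSg
  set Sh := noiseSum (1 - α) (hessianNoise F f α) ξ (pointAndStep x) with hSh
  have hZ : ∀ k ≤ K, Measurable[ℱ k] (pointAndStep x k) := fun k hk =>
    (hrun.point_measurable k hk).prodMk
      ((hrun.point_measurable k hk).sub (hrun.measurable_point (by omega)))
  have hSgm := measurable_noiseSum (c := 1 - α) (measurable_gradientNoise hF hf α) hZ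
    hrun.sample_measurable
  have hShm := measurable_noiseSum (c := 1 - α) (measurable_hessianNoise hF hf α) hZ
    hrun.sample_measurable
  have hg := hvar.integrable_gradientNoise α
  have hh := hvar.integrable_hessianNoise hα.le hα1.le
  have hSg2 := integrable_and_integral_sq_noiseSum_le (P := P) (C := α * σg) hα hα1.le
    (measurable_gradientNoise hF hf α) (fun a => (hg a).1) (fun a => (hg a).2.1)
    (fun a => (hg a).2.2.1) hZ hrun.sample_measurable hrun.sample_law hrun.sample_indep
    (fun k _ ω => (hg _).2.2.2)
  have hSh2 := integrable_and_integral_sq_noiseSum_le (P := P) (C := σH * (η / θ)) hα hα1.le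
    (measurable_hessianNoise hF hf α) (fun a => (hh a).1) (fun a => (hh a).2.1)
    (fun a => (hh a).2.2.1) hZ hrun.sample_measurable hrun.sample_law hrun.sample_indep
    (fun k hk ω => (hh _).2.2.2.trans (by
      rw [mul_pow]
      exact mul_le_mul_of_nonneg_left
        (pow_le_pow_left₀ (norm_nonneg _) (hrun.norm_step_le hθ hp hk ω) 2) (sq_nonneg _)))
  have hSg1 : ∀ k ≤ K + 1, Integrable (fun ω => ‖Sg k ω‖) P ∧ ∫ ω, ‖Sg k ω‖ ∂P ≤ r * σg :=
    fun k hk => integrable_and_integral_norm_le_of_sq ((hSgm k hk).mono (ℱ.le k) le_rfl)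
      (by positivity) (hSg2 k hk).1 ((hSg2 k hk).2.trans (by
        rw [div_le_iff₀ hα, ← hrα]; apply le_of_eq; ring))
  have hSh1 : ∀ k ≤ K + 1, Integrable (fun ω => ‖Sh k ω‖) P ∧
      ∫ ω, ‖Sh k ω‖ ∂P ≤ σH * (η / θ) / r :=
    fun k hk => integrable_and_integral_norm_le_of_sq ((hShm k hk).mono (ℱ.le k) le_rfl)
      (by positivity) (hSh2 k hk).1 ((hSh2 k hk).2.trans (by rw [div_pow, hrα]))
  have hGi : ∀ k ∈ Finset.range (K + 1),
      Integrable (fun ω => dualNorm p (gradient f (x k ω)) / 2) P := fun k hk =>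
    (hrun.integrable_comp_point hθ hp ((continuous_dualNorm hθ hp).comp hf.2.continuous)
      (by have := Finset.mem_range.1 hk; omega)).div_const 2
  have he0 : Integrable (fun ω => dualNorm p (m 0 ω - gradient f (x 0 ω))) P := by
    simp only [hrun.init_point]
    have h1 := hm₀.sub (integrable_const (gradient f x₀))
    refine (h1.norm.const_mul θ⁻¹).mono'
      ((continuous_dualNorm hθ hp).comp_aestronglyMeasurable h1.aestronglyMeasurable)
      (.of_forall fun ω => ?_)
    rw [Real.norm_of_nonneg (dualNorm_nonneg hθ hp _)]
    exact dualNorm_le_norm hθ hp _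
  have hni : ∀ k ∈ Finset.range (K + 1),
      Integrable (fun ω => 2 * ρ * (‖Sg k ω‖ + ‖Sh k ω‖)) P := fun k hk => by
    have hk' : k ≤ K + 1 := by have := Finset.mem_range.1 hk; omega
    exact ((hSg1 k hk').1.add (hSh1 k hk').1).const_mul _
  have hnsum := integrable_finsetSum (Finset.range (K + 1)) hni
  have hpath : ∀ ω, ∑ k ∈ Finset.range (K + 1), dualNorm p (gradient f (x k ω)) / 2 ≤
      ((f x₀ - ⨅ y, f y) / η
        + 2 / α * dualNorm p (m 0 ω - gradient f (x 0 ω)))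
      + ∑ k ∈ Finset.range (K + 1), 2 * ρ * (‖Sg k ω‖ + ‖Sh k ω‖)
      + ((K + 1 : ℕ) : ℝ) * (η ^ 2 / α * (M₀ + M₁ * (L₀ * η * q)) + η * q * L₀ / 2) := by
    intro ω
    have h := sum_half_dualNorm_gradient_le (x := fun k => x k ω) (m := fun k => m k ω)
      (S := fun k => Sg k ω + Sh k ω) (N := K + 1) hθ hp hρ hf hbdd hL₀ hL₁ hM₀ hM₁ hgrad hhess
      hη hα hα1.le hLη hMη hq (by simp [hSg, hSh, noiseSum])
      (fun k hk => hrun.point_step k (by omega) ω)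
      (fun k hk => momentum_error_step hα1 hrun (by omega) ω)
    have h2 : ∑ k ∈ Finset.range (K + 1), 2 * ρ * ‖Sg k ω + Sh k ω‖ ≤
        ∑ k ∈ Finset.range (K + 1), 2 * ρ * (‖Sg k ω‖ + ‖Sh k ω‖) :=
      Finset.sum_le_sum fun k _ =>
        mul_le_mul_of_nonneg_left (norm_add_le _ _) (by positivity)
    have h3 : f (x 0 ω) = f x₀ := by rw [hrun.init_point]
    rw [h3] at h
    linarith
  have hi1 : Integrable (fun ω => (f x₀ - ⨅ y, f y) / η
      + 2 / α * dualNorm p (m 0 ω - gradient f (x 0 ω))) P :=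
    (integrable_const _).add (he0.const_mul _)
  have hi2 : Integrable (fun ω => ((f x₀ - ⨅ y, f y) / η
      + 2 / α * dualNorm p (m 0 ω - gradient f (x 0 ω)))
      + ∑ k ∈ Finset.range (K + 1), 2 * ρ * (‖Sg k ω‖ + ‖Sh k ω‖)) P := hi1.add hnsum
  have hmono := (integral_mono (integrable_finsetSum _ hGi)
    (hi2.add (integrable_const _)) hpath).trans_eq
    (integral_add hi2 (integrable_const _))
  rw [integral_finsetSum _ hGi] at hmono
  refine hmono.trans ?_
  rw [integral_add hi1 hnsum,
    integral_add (integrable_const _) (he0.const_mul _), integral_finsetSum _ hni,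
    integral_const_mul (2 / α)]
  have hnoise : ∑ k ∈ Finset.range (K + 1), ∫ ω, 2 * ρ * (‖Sg k ω‖ + ‖Sh k ω‖) ∂P ≤
      ((K + 1 : ℕ) : ℝ) * (2 * ρ * (r * σg + σH * (η / θ) / r)) := by
    rw [← nsmul_eq_mul]
    refine (Finset.sum_le_card_nsmul _ _ (2 * ρ * (r * σg + σH * (η / θ) / r))
      fun k hk => ?_).trans_eq (by rw [Finset.card_range])
    have hk' : k ≤ K + 1 := by have := Finset.mem_range.1 hk; omega
    rw [integral_const_mul, integral_add (hSg1 k hk').1 (hSh1 k hk').1]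
    exact mul_le_mul_of_nonneg_left (add_le_add (hSg1 k hk').2 (hSh1 k hk').2) (by positivity)
  simp only [integral_const, probReal_univ, one_smul]
  linarith

end Run

/-! ### Choice of the parameters -/

/-- With `c = (K + 1) ^ (1/3)` the parameters are `α = c⁻²` and `η = ηhat c⁻²`, and `c ^ 2 ≥ 3/2`
because `K + 1 ≥ 2`. -/
lemma exists_cube_root {K : ℕ} (hK : 0 < K) :
    ∃ c : ℝ, 0 < c ∧ c ^ 3 = (K : ℝ) + 1 ∧ 3 / 2 ≤ c ^ 2 ∧ ((K : ℝ) + 1) ^ ((1 : ℝ) / 3) = c ∧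
      ((K : ℝ) + 1) ^ ((2 : ℝ) / 3) = c ^ 2 := by
  have hN : (0 : ℝ) ≤ (K : ℝ) + 1 := by positivity
  have hK1 : (1 : ℝ) ≤ K := by exact_mod_cast hK
  set c : ℝ := ((K : ℝ) + 1) ^ ((1 : ℝ) / 3) with hc
  have hc3 : c ^ 3 = (K : ℝ) + 1 := by
    rw [hc, ← Real.rpow_mul_natCast hN]
    norm_num
  refine ⟨c, by positivity, hc3, ?_, rfl, ?_⟩
  · by_contra! h
    have h1 : (c ^ 2) ^ 3 < (3 / 2) ^ 3 := pow_lt_pow_left₀ h (sq_nonneg c) (by norm_num)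
    have h2 : (c ^ 2) ^ 3 = ((K : ℝ) + 1) ^ 2 := by rw [← hc3]; ring
    nlinarith
  · rw [hc, ← Real.rpow_mul_natCast hN]
    norm_num

/-- The geometric factor from the gradient growth bound is dominated by the exponential in the
statement of the rate: `q = 1 + L₁ η q ≤ 1 + L₁ ηhat`, where `η = ηhat t`
and `t q ≤ 1`. -/
lemma growth_factor_le_exp {L₁ η ηhat t q : ℝ} (hL₁ : 0 ≤ L₁) (hηhat : 0 < ηhat)
    (ht : t ≤ 2 / 3) (hη : η = ηhat * t) (hLη : L₁ * η ≤ 2 / 9)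
    (hq : q * (1 - L₁ * η) = 1) : 0 ≤ q ∧ q ≤ Real.exp (L₁ * ηhat) := by
  have hq0 : 0 < q := by
    by_contra! h
    nlinarith
  have hq1 : q ≤ 9 / 7 := by nlinarith
  have htq : t * q ≤ 1 := by
    calc t * q ≤ 2 / 3 * (9 / 7) := by gcongr
      _ ≤ 1 := by norm_num
  have h1 : L₁ * ηhat * (t * q) ≤ L₁ * ηhat := mul_le_of_le_one_right (by positivity) htq
  refine ⟨hq0.le, ?_⟩
  have h2 := Real.add_one_le_exp (L₁ * ηhat)
  subst hη
  linarith

theorem theorem2 {d : ℕ} {Ξ Ω : Type*} [MeasurableSpace Ξ] [MeasurableSpace Ω]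
    (P : Measure Ω) [IsProbabilityMeasure P] (D : Measure Ξ) [IsProbabilityMeasure D]
    -- the norm, and its comparison with the Euclidean norm
    (p : Seminorm ℝ (Vec d)) (hp : ∀ v, p v = 0 → v = 0)
    (ρbar θlow : ℝ) (hρ : 0 ≤ ρbar) (hθ : 0 < θlow)
    (hρbar : ∀ v : Vec d, dualNorm p v ≤ ρbar * ‖v‖)
    (hθlow : ∀ v : Vec d, θlow * ‖v‖ ≤ p v)
    -- the problem
    (F : Ξ → Vec d → ℝ) (f : Vec d → ℝ) (σg σH L₀ L₁ M₀ M₁ : ℝ)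
    (hσg : 0 ≤ σg) (hσH : 0 ≤ σH) (hL₀ : 0 ≤ L₀) (hL₁ : 0 ≤ L₁) (hM₀ : 0 ≤ M₀) (hM₁ : 0 ≤ M₁)
    (hLM : L₁ ≠ 0 ∨ M₁ ≠ 0)
    (hF : IsStochasticObjective D F f) (hf : TwiceDifferentiable f)
    (hvar : UnbiasedBoundedVariance D F f σg σH)
    (hbdd : BddBelow (Set.range f))
    (hgrad : SymmLipschitzGradient p L₀ L₁ f)
    (hhess : SymmLipschitzHessian p M₀ M₁ f)
    -- the algorithm
    (K : ℕ) (hK : 0 < K) (ηhat η α : ℝ)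
    (hηhat : ηhat = etaHat L₁ M₁)
    (hα : α = 1 / ((K : ℝ) + 1) ^ ((2 : ℝ) / 3))
    (hη : η = ηhat / ((K : ℝ) + 1) ^ ((2 : ℝ) / 3))
    (ℱ : Filtration ℕ (inferInstance : MeasurableSpace Ω))
    (x₀ : Vec d) (ξ : ℕ → Ω → Ξ) (x m : ℕ → Ω → Vec d)
    (hrun : IsSecondOrderMomentumRun P D F p ℱ
      (fun _ => η) (fun _ => α) (fun _ => 1 - α) K x₀ ξ x m)
    (hm₀ : Integrable (m 0) P) :
    (∀ k ≤ K, Integrable (fun ω => dualNorm p (gradient f (x k ω))) P) ∧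
    (Finset.range (K + 1)).inf' Finset.nonempty_range_add_one
        (fun k => ∫ ω, dualNorm p (gradient f (x k ω)) ∂P) ≤
      2 * (f x₀ - ⨅ y, f y) / (ηhat * ((K : ℝ) + 1) ^ ((1 : ℝ) / 3))
      + 4 * ((∫ ω, dualNorm p (m 0 ω - gradient f (x 0 ω)) ∂P) + ρbar * σg)
          / ((K : ℝ) + 1) ^ ((1 : ℝ) / 3)
      + ηhat * L₀ * Real.exp (L₁ * ηhat) / ((K : ℝ) + 1) ^ ((2 : ℝ) / 3)
      + 2 * ηhat ^ 2 / ((K : ℝ) + 1) ^ ((2 : ℝ) / 3)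
          * (M₀ + 2 / 3 * M₁ * ηhat * L₀ * Real.exp (L₁ * ηhat))
      + 4 * (ρbar / θlow) * (ηhat * σH / ((K : ℝ) + 1) ^ ((1 : ℝ) / 3)) := by
  obtain ⟨c, hc0, hc3, hc2, hr1, hr2⟩ := exists_cube_root hK
  obtain ⟨hη0, hLη, hMη⟩ := etaHat_pos_and_mul_le hL₁ hM₁ hLM
  rw [← hηhat] at hη0 hLη hMη
  rw [hr2] at hα hη
  simp only [hr1, hr2]
  have ht : 1 / c ^ 2 ≤ 2 / 3 := by
    rw [div_le_iff₀ (by positivity)]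
    linarith
  have hηt : η = ηhat * (1 / c ^ 2) := by rw [hη]; ring
  have hηpos : 0 < η := by rw [hη]; positivity
  have hLη' : L₁ * η ≤ 2 / 9 := by
    calc L₁ * η = L₁ * ηhat * (1 / c ^ 2) := by rw [hηt]; ring
      _ ≤ 1 / 3 * (2 / 3) := by gcongr
      _ = 2 / 9 := by norm_num
  have hMη' : M₁ * η ^ 2 ≤ 2 / 27 * α := by
    calc M₁ * η ^ 2 = M₁ * ηhat ^ 2 * (1 / c ^ 2) * (1 / c ^ 2) := by rw [hηt]; ring
      _ ≤ 1 / 9 * (2 / 3) * (1 / c ^ 2) := by gcongr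
      _ = 2 / 27 * α := by rw [hα]; ring
  obtain ⟨q, hq⟩ : ∃ q : ℝ, q * (1 - L₁ * η) = 1 :=
    ⟨(1 - L₁ * η)⁻¹, inv_mul_cancel₀ (by linarith)⟩
  obtain ⟨hq0, hqexp⟩ := growth_factor_le_exp hL₁ hη0 ht hηt hLη' hq
  refine ⟨fun k hk => hrun.integrable_comp_point hθ hθlow
    ((continuous_dualNorm hθ hθlow).comp hf.2.continuous) (by omega), ?_⟩
  have hmain := sum_integral_half_dualNorm_gradient_le (r := 1 / c) hθ hθlow hρ hρbar hσg hσH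
    hL₀ hL₁ hM₀ hM₁ hF hf hvar hbdd hgrad hhess hηpos (by positivity)
    (by rw [hα, div_pow, one_pow]) (by rw [hα]; linarith) hLη' hMη' hq hrun hm₀
  simp only [integral_div] at hmain
  rw [← Finset.sum_div] at hmain
  set mn := (Finset.range (K + 1)).inf' Finset.nonempty_range_add_one
    (fun k => ∫ ω, dualNorm p (gradient f (x k ω)) ∂P) with hmn
  -- The minimum is at most the average.
  have hmin : c ^ 3 * mn ≤
      ∑ k ∈ Finset.range (K + 1), ∫ ω, dualNorm p (gradient f (x k ω)) ∂P := by
    have h := Finset.card_nsmul_le_sum (Finset.range (K + 1))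
      (fun k => ∫ ω, dualNorm p (gradient f (x k ω)) ∂P) mn (fun k hk => Finset.inf'_le _ hk)
    rw [Finset.card_range, nsmul_eq_mul] at h
    rw [hc3]
    exact_mod_cast h
  push_cast at hmain
  rw [← hc3, hα, hη] at hmain
  set Δ := f x₀ - ⨅ y, f y
  set e₀ := ∫ ω, dualNorm p (m 0 ω - gradient f (x 0 ω)) ∂P
  have hbound : mn ≤ 2 * Δ / (ηhat * c) + 4 * (e₀ + ρbar * σg) / c
      + ηhat * L₀ * q / c ^ 2
      + 2 * ηhat ^ 2 / c ^ 2 * (M₀ + 1 / c ^ 2 * M₁ * ηhat * L₀ * q)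
      + 4 * (ρbar / θlow) * (ηhat * σH / c) := by
    have h : c ^ 3 * mn ≤ c ^ 3 * (2 * Δ / (ηhat * c) + 4 * (e₀ + ρbar * σg) / c
        + ηhat * L₀ * q / c ^ 2
        + 2 * ηhat ^ 2 / c ^ 2 * (M₀ + 1 / c ^ 2 * M₁ * ηhat * L₀ * q)
        + 4 * (ρbar / θlow) * (ηhat * σH / c)) := by
      refine (hmin.trans ((div_le_iff₀ two_pos).1 hmain)).trans_eq ?_
      field_simp
      ring
    exact le_of_mul_le_mul_left h (by positivity)
  -- The curvature terms carry the bounds `1 / c ^ 2 ≤ 2 / 3` and `q ≤ exp (L₁ ηhat)`.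
  refine hbound.trans ?_
  gcongr
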